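/- All graphs are finite and simple. Let $a,b,n$ be positive integers with $a<b$. For a graph $G$ let $\delta(G)$ be its minimum degree, and let $i(G)$ be the number of its isolated vertices. The isolated toughness of $G$ is $$I(G)=\min\left\{\frac{|S|}{i(G-S)} : S\subseteq V(G),\ i(G-S)\ge 2\right\}$$ if $G$ is not complete, and $I(G)=|V(G)|-1$ if $G$ is complete. An $[a,b]$-factor of $G$ is a spanning subgraph $H$ of $G$ with $a\le d_H(x)\le b$ for every $x\in V(G)$. **Theorem.** If $\delta(G)\ge a+n$ and $I(G)\ge a-1+\dfrac{a+2n-1}{b}$, then for every matching $M$ of $G$ with exactly $n$ edges, the graph $G-M$ obtained from $G$ by deleting the edges of $M$ has an $[a,b]$-factor. -/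

import Mathlib

noncomputable section

/-- The number `i(G)` of isolated vertices of a graph. -/
def numIsolated {V : Type*} (G : SimpleGraph V) : ℕ :=
  {v : V | G.IsIsolated v}.ncard

/-- The number `i(G - S)`: isolated vertices of the graph obtained by deleting the vertex set `S`. -/
def numIsolatedDelete {V : Type*} (G : SimpleGraph V) (S : Finset V) : ℕ :=
  numIsolated (G.induce {v : V | v ∉ S})

/-- A graph that is not complete has a vertex set `S` with `i(G - S) ≥ 2`, so the minimum in the
definition of the isolated toughness is taken over a nonempty family. -/
theorem exists_two_le_numIsolatedDelete {V : Type*} [Fintype V] (G : SimpleGraph V)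
    (hG : G ≠ ⊤) :
    (Finset.univ.filter fun S : Finset V => 2 ≤ numIsolatedDelete G S).Nonempty := by
  classical
  obtain ⟨u, v, huv, hadj⟩ := SimpleGraph.ne_top_iff_exists_not_adj.mp hG
  refine ⟨Finset.univ \ {u, v}, Finset.mem_filter.mpr ⟨Finset.mem_univ _, ?_⟩⟩
  have key : ∀ w : V, w ∉ Finset.univ \ {u, v} → w = u ∨ w = v := by
    intro w hw
    by_contra h
    exact hw (by simpa using h)
  refine (Set.one_lt_ncard (Set.toFinite _)).mpr
    ⟨⟨u, by simp⟩, ?_, ⟨v, by simp⟩, ?_, by simpa using huv⟩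
  · rintro ⟨w, hw⟩ h
    rcases key w hw with rfl | rfl
    · simp at h
    · exact hadj (by simpa using h)
  · rintro ⟨w, hw⟩ h
    rcases key w hw with rfl | rfl
    · exact hadj (by simpa using h.symm)
    · simp at h

open Classical in
/-- The isolated toughness `I(G)`: the minimum of `|S| / i(G - S)` over all vertex sets `S` with
`i(G - S) ≥ 2` if `G` is not complete, and `|V(G)| - 1` if `G` is complete. -/
def isolatedToughness {V : Type*} [Fintype V] (G : SimpleGraph V) : ℝ :=
  if hG : G = ⊤ then (Fintype.card V : ℝ) - 1
  else (Finset.univ.filter fun S : Finset V => 2 ≤ numIsolatedDelete G S).inf'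
    (exists_two_le_numIsolatedDelete G hG)
    fun S => (S.card : ℝ) / (numIsolatedDelete G S : ℝ)

open Classical in
/-- `H` is an `[a,b]`-factor of `G`: a spanning subgraph of `G` all of whose degrees lie between
`a` and `b`. -/
def IsIntervalFactor {V : Type*} [Fintype V] (G : SimpleGraph V) (a b : ℕ)
    (H : SimpleGraph V) : Prop :=
  H ≤ G ∧ ∀ v : V, a ≤ H.degree v ∧ H.degree v ≤ b

end

namespace SimpleGraph
open Finset
open scoped Classical

variable {V : Type*} [Fintype V]

/-! By Lovász's criterion, if `G - M` has no factor there are disjoint `S`, `T` with `a|T| > b|S| +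
∑_T d'`, where `d'` is degree in `G - M - S`; vertices with `d' ≥ a` can be dropped from `T`. Let
`d` be degree in `G - S`. Deleting `M` costs each vertex at most 1 and all of them at most `2n`, so
`b|S| < ∑_T (a - d) + 2n`, with truncated differences. A greedy choice (`exists_isIndepSet_sum_le`)
bounds the sum by `∑_I (d + 1)(a - d)` for an independent `I ⊆ T`. If `|I| ≤ 1`, the minimum degree
makes `S` too large. Otherwise deleting `X = S ∪ N(I)` isolates `I`, and `b|X| < |I|(a + (a - 1)b) +
2n`, while toughness gives `b|X| ≥ |I|(a + (a - 1)b + 2n - 1)`; this is absurd as `2(2n - 1) ≥ 2n`.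
The criterion itself is proved by alternating chains. -/

/-! ### Edge exchanges and alternating chains. -/

theorem degree_sup_edge {H K : SimpleGraph V} {u x : V} (hK : K = H ⊔ edge u x) (hux : u ≠ x)
    (h : ¬ H.Adj u x) (v : V) :
    K.degree v = H.degree v + if v = u ∨ v = x then 1 else 0 := by
  have hx : ¬ H.Adj x u := fun h' => h h'.symm
  have hadj (w : V) : K.Adj v w ↔ H.Adj v w ∨ (v = u ∧ w = x ∨ v = x ∧ w = u) := by
    rw [hK, sup_adj, edge_adj]
    grind
  simp only [← card_neighborFinset_eq_degree]
  by_cases hu : v = u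
  · subst hu
    have : K.neighborFinset v = insert x (H.neighborFinset v) := by
      ext w
      simp only [mem_neighborFinset, hadj, mem_insert]
      grind
    rw [this, card_insert_of_notMem (by simpa using h)]
    simp
  by_cases hv : v = x
  · subst hv
    have : K.neighborFinset v = insert u (H.neighborFinset v) := by
      ext w
      simp only [mem_neighborFinset, hadj, mem_insert]
      grind
    rw [this, card_insert_of_notMem (by simpa using hx)]
    simp
  · have : K.neighborFinset v = H.neighborFinset v := by
      ext w
      simp only [mem_neighborFinset, hadj]
      grind
    rw [this]
    simp [hu, hv]

theorem degree_sdiff_edge {H K : SimpleGraph V} {x y : V} (hK : K = H \ edge x y)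
    (h : H.Adj x y) (v : V) :
    K.degree v + (if v = x ∨ v = y then 1 else 0) = H.degree v := by
  have hxy := h.ne
  refine (degree_sup_edge ?_ hxy ?_ v).symm
  · rw [hK, sdiff_sup_cancel]
    exact (edge_le_iff _).mpr (Or.inr h)
  · simp [hK, sdiff_adj, edge_adj, hxy]

/-- The total amount by which the degrees of `H` fall short of `g`. -/
noncomputable def deficiency (H : SimpleGraph V) (g : V → ℕ) : ℕ :=
  ∑ v, (g v - H.degree v)

/-- Replacing the edge `xy` of `H` by the edge `ux`. -/
def switch (H : SimpleGraph V) (u x y : V) : SimpleGraph V :=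
  (H ⊔ edge u x) \ edge x y

omit [Fintype V] in
theorem switch_adj (H : SimpleGraph V) {u x y v w : V} (hux : u ≠ x) (hxy : x ≠ y) :
    (H.switch u x y).Adj v w ↔ (H.Adj v w ∨ (v = u ∧ w = x) ∨ (v = x ∧ w = u)) ∧
      ¬ ((v = x ∧ w = y) ∨ (v = y ∧ w = x)) := by
  simp only [switch, sdiff_adj, sup_adj, edge_adj]
  grind

theorem degree_switch (H : SimpleGraph V) {u x y : V} (hux : u ≠ x) (h : ¬ H.Adj u x)
    (hxy : H.Adj x y) (v : V) :
    (H.switch u x y).degree v + (if v = y then 1 else 0) =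
      H.degree v + if v = u then 1 else 0 := by
  obtain ⟨K, hK⟩ : ∃ K, K = H ⊔ edge u x := ⟨_, rfl⟩
  have h1 := degree_sup_edge hK hux h v
  have h2 := degree_sdiff_edge (H := K) (K := H.switch u x y) (by rw [hK, switch])
    (by rw [hK]; exact Or.inl hxy) v
  have h3 := hxy.ne
  split_ifs at * <;> grind

/-- `u` starts an alternating chain with respect to `H` along which the degree of `u` can be
raised; the vertices of the chain that are not saturated have decreasing values of `φ`. -/
inductive Augmentable (G : SimpleGraph V) (g f : V → ℕ) (φ : V → ℕ) (H : SimpleGraph V) : V → Prop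
  | unsaturated {u x : V} : G.Adj u x → ¬ H.Adj u x → H.degree x < f x → H.degree u ≤ g u →
      Augmentable G g f φ H u
  | excess {u : V} : g u < H.degree u → Augmentable G g f φ H u
  | step {u x y : V} : G.Adj u x → ¬ H.Adj u x → f x ≤ H.degree x → H.Adj x y → φ y < φ u →
      H.degree u ≤ g u → Augmentable G g f φ H y → Augmentable G g f φ H u

/-- The rest of the chain survives the exchange: `φ` decreases along it, so it returns to neither
`u` nor `y`, and `x` is saturated, so it neither adds `ux` nor removes `xy`. -/
theorem Augmentable.switch {G H : SimpleGraph V} {g f φ : V → ℕ} (hgf : ∀ v, g v < f v)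
    {u x y : V} (hu : H.degree u < g u) (hux : G.Adj u x) (hnux : ¬ H.Adj u x)
    (hx : f x ≤ H.degree x) (hxy : H.Adj x y) (hyu : φ y < φ u)
    (hy : H.degree y ≤ g y) {z : V} (hz : Augmentable G g f φ H z) (hzy : z = y ∨ φ z < φ y) :
    Augmentable G g f φ (H.switch u x y) z := by
  have hdeg := degree_switch H hux.ne hnux hxy
  have hadj := fun v w => switch_adj H (v := v) (w := w) hux.ne hxy.ne
  have hyne : y ≠ u := by rintro rfl; exact hyu.false
  have hgx := hgf x
  induction hz with
  | @unsaturated p q hpq hnpq hq hp =>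
    have hpu : p ≠ u := by rintro rfl; grind
    have hpx : p ≠ x := by rintro rfl; omega
    have hdq := hdeg q
    have hdp := hdeg p
    have hgq := hgf q
    refine .unsaturated hpq ?_ ?_ ?_ (x := q)
    · rw [hadj]; grind
    · split_ifs at hdq <;> grind
    · split_ifs at hdp <;> grind
  | @excess p hp =>
    have hpu : p ≠ u := by rintro rfl; grind
    have hpy : p ≠ y := by rintro rfl; omega
    have hdp := hdeg p
    refine .excess ?_
    split_ifs at hdp <;> grind
  | @step p q r hpq hnpq hq hqr hrp hp hr ih =>
    have hpu : p ≠ u := by rintro rfl; grind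
    have hpx : p ≠ x := by rintro rfl; omega
    have hgq := hgf q
    have hgy := hgf y
    have hry : φ r < φ y := by grind
    have hdq := hdeg q
    have hdp := hdeg p
    have hqu : q ≠ u := by rintro rfl; omega
    have hqy : q ≠ y := by rintro rfl; omega
    refine .step hpq ?_ ?_ ?_ hrp ?_ (ih (Or.inr hry)) (x := q)
    · rw [hadj]; grind
    · split_ifs at hdq <;> grind
    · rw [hadj]; grind
    · split_ifs at hdp <;> grind

/-- A switch moves one unit of deficiency from `u` to `y`, where `φ` is smaller; if `y` has excess
degree, the unit vanishes. -/
theorem Augmentable.exists_deficiency_lt {G H : SimpleGraph V} {g f φ : V → ℕ}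
    (hgf : ∀ v, g v < f v) (hHG : H ≤ G) (hf : ∀ v, H.degree v ≤ f v) {u : V}
    (hu : H.degree u < g u) (h : Augmentable G g f φ H u) :
    ∃ K : SimpleGraph V, K ≤ G ∧ (∀ v, K.degree v ≤ f v) ∧ K.deficiency g < H.deficiency g := by
  induction hk : φ u using Nat.strong_induction_on generalizing H u with
  | _ k ih =>
  subst hk
  have hgu := hgf u
  cases h with
  | @unsaturated _ x hux hnux hx _ =>
    obtain ⟨K, hK⟩ : ∃ K, K = H ⊔ edge u x := ⟨_, rfl⟩
    have hdeg := degree_sup_edge hK hux.ne hnux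
    refine ⟨K, ?_, fun v => ?_, ?_⟩
    · rw [hK]
      exact sup_le hHG ((edge_le_iff _).mpr (Or.inr hux))
    · have := hdeg v
      have := hf v
      split_ifs at * <;> grind
    · refine sum_lt_sum (fun v _ => ?_) ⟨u, mem_univ _, ?_⟩
      · have := hdeg v
        omega
      · have := hdeg u
        simp only [true_or, if_true] at this
        omega
  | excess h => omega
  | @step _ x y hux hnux hx hxy hyu _ hy =>
    have hdeg := degree_switch H hux.ne hnux hxy
    have hadj := fun v w => switch_adj H (v := v) (w := w) hux.ne hxy.ne
    have hyne : y ≠ u := by rintro rfl; exact hyu.false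
    have hle : H.switch u x y ≤ G := by
      intro v w hvw
      rw [hadj] at hvw
      rcases hvw.1 with h | ⟨rfl, rfl⟩ | ⟨rfl, rfl⟩
      exacts [hHG h, hux, hux.symm]
    have hf' (v : V) : (H.switch u x y).degree v ≤ f v := by
      have := hdeg v
      have := hf v
      split_ifs at * <;> grind
    have hdu := hdeg u
    have hdy := hdeg y
    simp only [hyne, hyne.symm, if_true, if_false] at hdu hdy
    by_cases hyg : H.degree y ≤ g y
    · obtain ⟨K, hKG, hKf, hK⟩ := ih _ hyu hle hf' (by omega)
        (hy.switch hgf hu hux hnux hx hxy hyu hyg (Or.inl rfl)) rfl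
      refine ⟨K, hKG, hKf, hK.trans_le ?_⟩
      unfold deficiency
      rw [← add_sum_erase univ _ (mem_univ u), ← add_sum_erase univ _ (mem_univ u),
        ← add_sum_erase (univ.erase u) _ (mem_erase.mpr ⟨hyne, mem_univ y⟩),
        ← add_sum_erase (univ.erase u) _ (mem_erase.mpr ⟨hyne, mem_univ y⟩)]
      have : ∑ v ∈ (univ.erase u).erase y, (g v - (H.switch u x y).degree v) =
          ∑ v ∈ (univ.erase u).erase y, (g v - H.degree v) := by
        refine sum_congr rfl fun v hv => ?_
        have := hdeg v
        simp only [mem_erase] at hv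
        simp only [hv.1, hv.2.1, if_false] at this
        omega
      omega
    · refine ⟨_, hle, hf', sum_lt_sum (fun v _ => ?_) ⟨u, mem_univ _, by omega⟩⟩
      have := hdeg v
      split_ifs at * <;> grind

/-- `T` consists of the vertices from which no alternating walk reaches an excess vertex or an
unsaturated one. -/
theorem exists_closed_of_not_augmentable {G H : SimpleGraph V} {g f : V → ℕ}
    (h : ∀ φ : V → ℕ, ∀ u, H.degree u < g u → ¬ Augmentable G g f φ H u) :
    ∃ T : Finset V, (∀ u, H.degree u < g u → u ∈ T) ∧ (∀ u ∈ T, H.degree u ≤ g u) ∧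
      ∀ u ∈ T, ∀ x, G.Adj u x → ¬ H.Adj u x →
        f x ≤ H.degree x ∧ ∀ y, H.Adj x y → y ∈ T := by
  let L : ℕ → Set V := fun k => Nat.rec
    {u | g u < H.degree u ∨ ∃ x, G.Adj u x ∧ ¬ H.Adj u x ∧ H.degree x < f x}
    (fun _ s => {u | ∃ x y, G.Adj u x ∧ ¬ H.Adj u x ∧ H.Adj x y ∧ y ∈ s}) k
  -- The first layer containing `u`, so shortest walks have decreasing `φ`. The value 0 outside all
  -- layers is never used.
  let φ : V → ℕ := fun u => sInf {k | u ∈ L k}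
  have hφ {k : ℕ} {u : V} (hu : u ∈ L k) : φ u ≤ k := Nat.sInf_le hu
  have hφ' {k : ℕ} {u : V} (hu : u ∈ L k) : u ∈ L (φ u) :=
    Nat.sInf_mem (s := {k | u ∈ L k}) ⟨k, hu⟩
  have aug (k : ℕ) (u : V) (hk : φ u = k) (hu : u ∈ L k) : Augmentable G g f φ H u := by
    induction k using Nat.strong_induction_on generalizing u with
    | _ k ih =>
    by_cases hug : g u < H.degree u
    · exact .excess hug
    rw [not_lt] at hug
    cases k with
    | zero =>
      rcases hu with hu | ⟨x, hux, hnux, hx⟩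
      · omega
      · exact .unsaturated hux hnux hx hug
    | succ k =>
      obtain ⟨x, y, hux, hnux, hxy, hy⟩ := hu
      have hyk := hφ hy
      by_cases hx : H.degree x < f x
      · exact .unsaturated hux hnux hx hug
      · exact .step hux hnux (not_lt.mp hx) hxy (by omega) hug
          (ih _ (by omega) y rfl (hφ' hy))
  obtain ⟨T, hT⟩ : ∃ T : Finset V, ∀ u, u ∈ T ↔ ∀ k, u ∉ L k :=
    ⟨(Set.toFinite {u | ∀ k, u ∉ L k}).toFinset, by simp⟩
  refine ⟨T, fun u hu => ?_, fun u hu => ?_, fun u hu x hux hnux => ⟨?_, fun y hxy => ?_⟩⟩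
  · exact (hT u).mpr fun k hk => h φ u hu (aug _ u rfl (hφ' hk))
  · exact not_lt.mp fun h' => (hT u).mp hu 0 (Or.inl h')
  · exact not_lt.mp fun h' => (hT u).mp hu 0 (Or.inr ⟨x, hux, hnux, h'⟩)
  · exact (hT y).mpr fun k hk => (hT u).mp hu (k + 1) ⟨x, y, hux, hnux, hxy, hk⟩

/-! ### Lovász's criterion. -/

/-- The criterion of Lovász for the existence of a `(g, f)`-factor, in the case `g < f`. -/
theorem exists_factor_of_forall_disjoint {G : SimpleGraph V} {g f : V → ℕ}
    (hgf : ∀ v, g v < f v)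
    (h : ∀ S T : Finset V, Disjoint S T →
      ∑ v ∈ T, g v ≤ ∑ v ∈ S, f v + ∑ v ∈ T, (G.neighborFinset v \ S).card) :
    ∃ H : SimpleGraph V, H ≤ G ∧ ∀ v, g v ≤ H.degree v ∧ H.degree v ≤ f v := by
  suffices key : ∀ k, ∀ H : SimpleGraph V, H ≤ G → (∀ v, H.degree v ≤ f v) →
      H.deficiency g = k → ∃ K : SimpleGraph V, K ≤ G ∧ ∀ v, g v ≤ K.degree v ∧ K.degree v ≤ f v by
    refine key _ ⊥ bot_le (fun v => ?_) rfl
    simp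
  intro k
  induction k using Nat.strong_induction_on with
  | _ k ih =>
  intro H hHG hf hk
  by_cases hdef : ∀ v, g v ≤ H.degree v
  · exact ⟨H, hHG, fun v => ⟨hdef v, hf v⟩⟩
  push Not at hdef
  obtain ⟨u, hu⟩ := hdef
  by_cases haug : ∃ φ : V → ℕ, ∃ u, H.degree u < g u ∧ Augmentable G g f φ H u
  · obtain ⟨φ, u, hu, ha⟩ := haug
    obtain ⟨K, hKG, hKf, hK⟩ := ha.exists_deficiency_lt hgf hHG hf hu
    exact ih _ (hk ▸ hK) K hKG hKf rfl
  push Not at haug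
  obtain ⟨T, hdT, hT, hcl⟩ := exists_closed_of_not_augmentable haug
  exfalso
  -- All `H`-edges at `S` go to `T`, and all `G`-edges from `T` that avoid `S` lie in `H`. So the
  -- right side of the criterion is at most `∑_T d_H < ∑_T g`.
  let S : Finset V := univ.filter fun x => ∃ u ∈ T, G.Adj u x ∧ ¬ H.Adj u x
  have hS (x : V) (hx : x ∈ S) : f x ≤ H.degree x ∧ H.neighborFinset x ⊆ T := by
    obtain ⟨u, huT, hux, hnux⟩ := (mem_filter.mp hx).2
    refine ⟨(hcl u huT x hux hnux).1, fun y hy => (hcl u huT x hux hnux).2 y ?_⟩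
    simpa using hy
  have hdisj : Disjoint S T := by
    rw [Finset.disjoint_left]
    intro x hx hxT
    have := (hS x hx).1
    have := hT x hxT
    have := hgf x
    omega
  have h1 : ∑ x ∈ S, f x ≤ ∑ v ∈ T, (H.neighborFinset v ∩ S).card := by
    calc ∑ x ∈ S, f x ≤ ∑ x ∈ S, (bipartiteAbove H.Adj T x).card := by
          refine sum_le_sum fun x hx => (hS x hx).1.trans (card_le_card fun y hy => ?_)
          exact mem_filter.mpr ⟨(hS x hx).2 hy, by simpa using hy⟩
      _ = ∑ v ∈ T, (bipartiteBelow H.Adj S v).card :=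
          sum_card_bipartiteAbove_eq_sum_card_bipartiteBelow _
      _ = _ := by
          refine sum_congr rfl fun v _ => congrArg card ?_
          ext x
          simp [bipartiteBelow, and_comm, H.adj_comm]
  have h2 : ∑ v ∈ T, (G.neighborFinset v \ S).card ≤ ∑ v ∈ T, (H.neighborFinset v \ S).card := by
    refine sum_le_sum fun v hv => card_le_card fun x hx => ?_
    simp only [mem_sdiff, mem_neighborFinset] at hx ⊢
    refine ⟨?_, hx.2⟩
    by_contra hvx
    exact hx.2 (mem_filter.mpr ⟨mem_univ _, v, hv, hx.1, hvx⟩)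
  have h3 : ∑ v ∈ T, (H.neighborFinset v ∩ S).card + ∑ v ∈ T, (H.neighborFinset v \ S).card =
      ∑ v ∈ T, H.degree v := by
    rw [← sum_add_distrib]
    exact sum_congr rfl fun v _ => card_inter_add_card_sdiff _ _
  have h4 : ∑ v ∈ T, H.degree v < ∑ v ∈ T, g v := sum_lt_sum hT ⟨u, hdT u hu, hu⟩
  have := h S T hdisj
  omega

/-! ### Independent sets and isolated toughness. -/

/-- A weighted greedy lower bound for independent sets: choose a vertex of largest weight `w`,
discard its neighbours, and repeat. -/
theorem exists_isIndepSet_sum_le (G : SimpleGraph V) (w d : V → ℕ) (T : Finset V)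
    (hd : ∀ v ∈ T, (G.neighborFinset v ∩ T).card ≤ d v) :
    ∃ I ⊆ T, G.IsIndepSet (I : Set V) ∧ ∑ v ∈ T, w v ≤ ∑ v ∈ I, (d v + 1) * w v := by
  induction T using Finset.strongInduction with
  | _ T ih =>
  rcases T.eq_empty_or_nonempty with rfl | hT
  · exact ⟨∅, subset_rfl, by simp [IsIndepSet], by simp⟩
  obtain ⟨x, hx, hmax⟩ := T.exists_max_image w hT
  set N : Finset V := insert x (G.neighborFinset x ∩ T) with hN
  have hNT : N ⊆ T := insert_subset hx inter_subset_right
  have hxN : x ∈ N := mem_insert_self _ _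
  obtain ⟨I, hIT, hI, hsum⟩ := ih (T \ N) (sdiff_ssubset hNT ⟨x, hxN⟩) fun v hv =>
    (card_le_card (inter_subset_inter_left sdiff_subset)).trans (hd v (mem_sdiff.mp hv).1)
  have hxI : x ∉ I := fun h => (mem_sdiff.mp (hIT h)).2 hxN
  refine ⟨insert x I, insert_subset hx (hIT.trans sdiff_subset), ?_, ?_⟩
  · have : Std.Symm fun v w => ¬ G.Adj v w := ⟨fun _ _ h h' => h h'.symm⟩
    rw [coe_insert, IsIndepSet, Set.pairwise_insert_of_symm]
    refine ⟨hI, fun v hv _ hadj => ?_⟩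
    have := mem_sdiff.mp (hIT hv)
    exact this.2 (mem_insert_of_mem (mem_inter.mpr ⟨by simpa using hadj, this.1⟩))
  · rw [sum_insert hxI, ← sum_sdiff hNT, add_comm]
    refine add_le_add ?_ hsum
    calc ∑ v ∈ N, w v ≤ N.card * w x := by
          simpa using sum_le_card_nsmul N w (w x) fun v hv => hmax v (hNT hv)
      _ ≤ _ := Nat.mul_le_mul_right _ ((card_insert_le _ _).trans
          (Nat.add_le_add_right (hd x hx) 1))

omit [Fintype V] in
theorem card_le_numIsolatedDelete [Finite V] {G : SimpleGraph V} {X I : Finset V} (hIX : Disjoint I X)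
    (h : ∀ v ∈ I, ∀ w, G.Adj v w → w ∈ X) : I.card ≤ numIsolatedDelete G X := by
  have hmem : ∀ v ∈ I, v ∈ {v : V | v ∉ X} := fun v hv => Finset.disjoint_left.mp hIX hv
  rw [numIsolatedDelete, numIsolated, ← card_attach, ← Set.ncard_coe_finset]
  refine Set.ncard_le_ncard_of_injOn
    (fun v => if hv : v.1 ∈ {v : V | v ∉ X} then ⟨v.1, hv⟩ else ⟨_, hmem v.1 v.2⟩) ?_ ?_
      (Set.toFinite _)
  · rintro ⟨v, hv⟩ -
    rw [dif_pos (hmem v hv)]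
    rintro ⟨w, hw⟩ hadj
    exact hw (h v hv w (by simpa using hadj))
  · rintro ⟨v, hv⟩ - ⟨w, hw⟩ - hvw
    simp only [hmem v hv, hmem w hw, dif_pos] at hvw
    simpa using hvw

theorem isolatedToughness_mul_card_le {G : SimpleGraph V} {X I : Finset V} (hIX : Disjoint I X)
    (h : ∀ v ∈ I, ∀ w, G.Adj v w → w ∈ X) (hI : 2 ≤ I.card) :
    isolatedToughness G * I.card ≤ X.card := by
  have hle := card_le_numIsolatedDelete hIX h
  have hG : G ≠ ⊤ := by
    rintro rfl
    obtain ⟨u, hu, v, hv, huv⟩ := one_lt_card.mp hI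
    exact Finset.disjoint_left.mp hIX hv (h u hu v (by simpa using huv))
  have hpos : (0 : ℝ) < numIsolatedDelete G X := by
    exact_mod_cast (by omega : 0 < numIsolatedDelete G X)
  have hinf : isolatedToughness G ≤ (X.card : ℝ) / numIsolatedDelete G X := by
    rw [isolatedToughness, dif_neg hG]
    exact inf'_le (fun S : Finset V => (S.card : ℝ) / numIsolatedDelete G S) (mem_filter.mpr ⟨mem_univ _, hI.trans hle⟩)
  calc isolatedToughness G * I.card
      ≤ (X.card : ℝ) / numIsolatedDelete G X * I.card := by gcongr
    _ ≤ (X.card : ℝ) / numIsolatedDelete G X * numIsolatedDelete G X := by gcongr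
    _ = X.card := div_mul_cancel₀ _ hpos.ne'

/-! ### Deleting the matching, and the main inequality. -/

theorem Subgraph.sum_degree_spanningCoe {G : SimpleGraph V} (M : G.Subgraph) :
    ∑ v, M.spanningCoe.degree v = 2 * M.edgeSet.ncard := by
  rw [sum_degrees_eq_twice_card_edges, ← M.edgeSet_spanningCoe, ← coe_edgeFinset,
    Set.ncard_coe_finset]

theorem Subgraph.IsMatching.degree_spanningCoe_le_one {G : SimpleGraph V} {M : G.Subgraph}
    (hM : M.IsMatching) (v : V) : M.spanningCoe.degree v ≤ 1 := by
  rw [← card_neighborFinset_eq_degree, card_le_one]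
  intro x hx y hy
  simp only [mem_neighborFinset, Subgraph.spanningCoe_adj] at hx hy
  exact hM.eq_of_adj_left hx hy

theorem Subgraph.card_neighborFinset_sdiff_le {G : SimpleGraph V} (M : G.Subgraph) (S : Finset V)
    (v : V) : (G.neighborFinset v \ S).card ≤
      ((G.deleteEdges M.edgeSet).neighborFinset v \ S).card + M.spanningCoe.degree v := by
  rw [← card_neighborFinset_eq_degree]
  refine le_trans (card_le_card fun x hx => ?_) (card_union_le _ _)
  simp only [mem_union, mem_sdiff, mem_neighborFinset, SimpleGraph.deleteEdges_adj, Subgraph.mem_edgeSet,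
    Subgraph.spanningCoe_adj] at hx ⊢
  tauto

/-- The inequality at the heart of the theorem: `d` and `d'` stand for the degrees outside `S`
before and after deleting edges, `n` for the number of edges deleted. -/
theorem mul_card_le_of_isolatedToughness {G : SimpleGraph V} {a b n : ℕ}
    (hab : a < b) (hn : 1 ≤ n) (hδ : ∀ v, a + n ≤ G.degree v)
    (hI : (a : ℝ) - 1 + ((a : ℝ) + 2 * (n : ℝ) - 1) / (b : ℝ) ≤ isolatedToughness G)
    {S T : Finset V} (hST : Disjoint S T) {m d' : V → ℕ} (hd' : ∀ v ∈ T, d' v < a)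
    (hdm : ∀ v ∈ T, (G.neighborFinset v \ S).card ≤ d' v + m v) (hm1 : ∀ v, m v ≤ 1)
    (hm : ∑ v ∈ T, m v ≤ 2 * n) :
    T.card * a ≤ S.card * b + ∑ v ∈ T, d' v := by
  by_contra! hlt
  set d : V → ℕ := fun v => (G.neighborFinset v \ S).card with hd
  have hmin (v : V) : a + n ≤ S.card + d v := by
    refine (hδ v).trans ?_
    rw [← card_neighborFinset_eq_degree]
    have := le_card_sdiff S (G.neighborFinset v)
    simp only [hd]
    omega
  have hTne : T.Nonempty := by
    rw [nonempty_iff_ne_empty]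
    rintro rfl
    simp at hlt
  obtain ⟨I, hIT, hindep, hsum⟩ := exists_isIndepSet_sum_le G (fun v => a - d v) d
    (T.filter fun v => d v < a) fun v hv => card_le_card fun w hw => by
      simp only [mem_inter, mem_filter, mem_sdiff] at hw ⊢
      exact ⟨hw.1, fun h => Finset.disjoint_left.mp hST h hw.2.1⟩
  have hIT' : I ⊆ T := hIT.trans (filter_subset _ _)
  have hIa (v : V) (hv : v ∈ I) : d v < a := (mem_filter.mp (hIT hv)).2
  have hS : S.card * b < ∑ v ∈ I, (d v + 1) * (a - d v) + 2 * n := by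
    have h1 : T.card * a ≤ ∑ v ∈ T, (a - d v) + ∑ v ∈ T, m v + ∑ v ∈ T, d' v := by
      rw [← smul_eq_mul, ← sum_const, ← sum_add_distrib, ← sum_add_distrib]
      refine sum_le_sum fun v hv => ?_
      have := hdm v hv
      simp only [hd]
      omega
    have h2 : ∑ v ∈ T, (a - d v) = ∑ v ∈ T.filter (fun v => d v < a), (a - d v) := by
      rw [sum_filter]
      refine sum_congr rfl fun v _ => ?_
      split_ifs <;> omega
    omega
  rcases Nat.lt_or_ge I.card 2 with hc | hc
  · obtain hc | hc : I.card = 0 ∨ I.card = 1 := by omega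
    · rw [card_eq_zero] at hc
      subst hc
      obtain ⟨x, hx⟩ := hTne
      have h1 := hmin x
      have h2 := hdm x hx
      have h3 := hm1 x
      have h4 := hd' x hx
      -- Here `d x ≤ d' x + 1 ≤ a`, so `a + n ≤ |S| + d x` forces `|S| ≥ n`, and `b ≥ 2` finishes.
      have h5 : n ≤ S.card := by simp only [hd] at h1; omega
      simp only [sum_empty] at hS
      nlinarith
    · obtain ⟨x, rfl⟩ := card_eq_one.mp hc
      have h1 := hmin x
      obtain ⟨c, hc⟩ := Nat.exists_eq_add_of_lt (hIa x (mem_singleton_self x))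
      simp only [sum_singleton] at hS
      have h2 : a - d x = c + 1 := by omega
      rw [h2] at hS
      have h3 : c + 1 + n ≤ S.card := by omega
      have h4 : (c + 1 + n) * b ≤ S.card * b := Nat.mul_le_mul_right _ h3
      have h5 : (d x + 1) * (c + 1) ≤ b * (c + 1) := Nat.mul_le_mul_right _ (by omega)
      have h6 : n * 2 ≤ n * b := Nat.mul_le_mul_left _ (by omega)
      nlinarith
  · set X : Finset V := S ∪ I.biUnion fun v => G.neighborFinset v \ S with hX
    have hIX : Disjoint I X := by
      rw [Finset.disjoint_left]
      intro v hv hvX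
      rcases mem_union.mp hvX with h | h
      · exact Finset.disjoint_left.mp hST h (hIT' hv)
      · obtain ⟨w, hw, hvw⟩ := mem_biUnion.mp h
        simp only [mem_sdiff, mem_neighborFinset] at hvw
        exact hindep hw hv hvw.1.ne hvw.1
    have htough := isolatedToughness_mul_card_le (G := G) hIX (fun v hv w hvw => by
      by_cases hwS : w ∈ S
      · exact mem_union_left _ hwS
      · exact mem_union_right _ (mem_biUnion.mpr ⟨v, hv, by simp [hvw, hwS]⟩)) hc
    have hXc : X.card ≤ S.card + ∑ v ∈ I, d v :=
      (card_union_le _ _).trans (Nat.add_le_add_left card_biUnion_le _)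
    -- With `a = d + c + 1`, the slack in each term is `c(b - d) ≥ 0`.
    have hterm : ∑ v ∈ I, ((d v + 1) * (a - d v) + d v * b) ≤ I.card * (a + (a - 1) * b) := by
      rw [← smul_eq_mul]
      refine sum_le_card_nsmul _ _ _ fun v hv => ?_
      obtain ⟨c, hc⟩ := Nat.exists_eq_add_of_lt (hIa v hv)
      have h2 : a - d v = c + 1 := by omega
      have h3 : a - 1 = d v + c := by omega
      have h4 : d v * c ≤ b * c := Nat.mul_le_mul_right _ (by omega)
      rw [h2, h3, hc]
      nlinarith
    have hXb : X.card * b + 1 ≤ I.card * (a + (a - 1) * b) + 2 * n := by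
      rw [sum_add_distrib, ← sum_mul] at hterm
      nlinarith [Nat.mul_le_mul_right b hXc]
    have ha : 1 ≤ a := by
      obtain ⟨x, hx⟩ := hTne
      have := hd' x hx
      omega
    have hb : (0 : ℝ) < b := by exact_mod_cast (by omega : 0 < b)
    have hXb' : (X.card : ℝ) * b + 1 ≤ I.card * (a + (a - 1) * b) + 2 * n := by
      have : ((a - 1 : ℕ) : ℝ) = (a : ℝ) - 1 := by push_cast [ha]; ring
      rw [← this]
      exact_mod_cast hXb
    have hmul : ((a : ℝ) - 1) * b + (a + 2 * n - 1) ≤ isolatedToughness G * b := by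
      have := mul_le_mul_of_nonneg_right hI hb.le
      rwa [add_mul, div_mul_cancel₀ _ hb.ne'] at this
    have hc' : (2 : ℝ) ≤ I.card := by exact_mod_cast hc
    have hn' : (1 : ℝ) ≤ n := by exact_mod_cast hn
    have h1 : (((a : ℝ) - 1) * b + (a + 2 * n - 1)) * I.card ≤ X.card * b := by
      calc _ ≤ isolatedToughness G * b * I.card := by gcongr
        _ = isolatedToughness G * I.card * b := by ring
        _ ≤ _ := by gcongr
    nlinarith [mul_le_mul hc' (by linarith : (1 : ℝ) ≤ 2 * n - 1) zero_le_one (by linarith)]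

end SimpleGraph

open SimpleGraph Finset in
theorem theorem2p3 {V : Type*} [Fintype V] (G : SimpleGraph V) [DecidableRel G.Adj]
    (a b n : ℕ) (ha : 1 ≤ a) (hab : a < b) (hn : 1 ≤ n)
    (hδ : a + n ≤ G.minDegree)
    (hI : (a : ℝ) - 1 + ((a : ℝ) + 2 * (n : ℝ) - 1) / (b : ℝ) ≤ isolatedToughness G)
    (M : G.Subgraph) (hM : M.IsMatching) (hcard : M.edgeSet.ncard = n) :
    ∃ H : SimpleGraph V, IsIntervalFactor (G.deleteEdges M.edgeSet) a b H := by
  classical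
  obtain ⟨G', hG'⟩ : ∃ G', G' = G.deleteEdges M.edgeSet := ⟨_, rfl⟩
  rw [← hG']
  refine exists_factor_of_forall_disjoint (g := fun _ => a) (f := fun _ => b) (fun _ => hab)
    fun S T hST => ?_
  simp only [sum_const, smul_eq_mul]
  set d' : V → ℕ := fun v => (G'.neighborFinset v \ S).card with hd'
  have hmain := mul_card_le_of_isolatedToughness (G := G) (T := T.filter fun v => d' v < a)
    (d' := d') (m := fun v => M.spanningCoe.degree v) hab hn
    (fun v => hδ.trans ((G.minDegree_le_degree v).trans_eq (by congr!))) hI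
    (hST.mono_right (filter_subset _ _)) (fun v hv => (mem_filter.mp hv).2)
    (fun v _ => by subst hG'; convert M.card_neighborFinset_sdiff_le S v)
    hM.degree_spanningCoe_le_one
    ((sum_le_univ_sum_of_nonneg fun _ => Nat.zero_le _).trans
      (by rw [M.sum_degree_spanningCoe, hcard]))
  -- The vertices dropped from `T` contribute at least `a` each to the right side.
  have hhigh : (T.filter fun v => ¬ d' v < a).card * a ≤ ∑ v ∈ T.filter (fun v => ¬ d' v < a), d' v := by
    rw [← smul_eq_mul]
    exact card_nsmul_le_sum _ _ _ fun v hv => not_lt.mp (mem_filter.mp hv).2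
  rw [← card_filter_add_card_filter_not (s := T) (fun v => d' v < a), add_mul,
    ← sum_filter_add_sum_filter_not T (fun v => d' v < a)]
  simp only [hd'] at *
  omega
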